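/- Let $M$ be a smooth (Hausdorff) manifold of dimension $2n+1$, $n\ge 0$, with an almost contact metric structure $(\varphi,\xi,\eta,g)$, i.e. a smooth $(1,1)$-tensor field $\varphi$, vector field $\xi$, one-form $\eta$ and Riemannian metric $g$ with $\eta(\xi)=1$, $\varphi^2=-I+\eta\otimes\xi$ and $g(\varphi X,\varphi Y)=g(X,Y)-\eta(X)\eta(Y)$. Let $\nabla$ be the Levi-Civita connection of $g$, and put $R_{XY}Z=\nabla_X\nabla_YZ-\nabla_Y\nabla_XZ-\nabla_{[X,Y]}Z$ and $R(X,Y,Z,W)=-g(R_{XY}Z,W)$. Put $d\eta(X,Y)=\tfrac12\big(X\eta(Y)-Y\eta(X)-\eta([X,Y])\big)$ and $h=\tfrac12\mathcal L_\xi\varphi$. Suppose that the structure is contact metric, i.e. $d\eta(X,Y)=g(X,\varphi Y)$, that $\xi$ belongs to the $(\kappa,\mu)$-nullity distribution for some constants $\kappa,\mu\in\mathbb R$, i.e. $$R_{XY}\xi=\kappa\big(\eta(Y)X-\eta(X)Y\big)+\mu\big(\eta(Y)hX-\eta(X)hY\big),$$ and that $M$ satisfies the $(G1)$ identity $$R(X,Y,\varphi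 Z,\varphi W)-R(X,Y,Z,W)=g(Y,\varphi W)g(X,\varphi Z)-g(X,\varphi W)g(Y,\varphi Z)+g(X,W)g(Y,Z)-g(Y,W)g(X,Z),$$ each for all smooth vector fields $X,Y,Z,W$ on $M$. Then $M$ is Sasakian, that is, the contact metric structure is normal: $$\varphi^2[X,Y]+[\varphi X,\varphi Y]-\varphi[\varphi X,Y]-\varphi[X,\varphi Y]+2\,d\eta(X,Y)\,\xi=0\quad\text{for all smooth vector fields }X,Y.$$ Moreover, if $M$ is non-empty and $n\ge1$, then $\kappa=1$. -/

import Mathlib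

open Bundle Manifold
open scoped Manifold ContDiff

noncomputable section

section Riemannian

variable {E : Type*} [NormedAddCommGroup E] [NormedSpace ℝ E]
  {H : Type*} [TopologicalSpace H] {I : ModelWithCorners ℝ E H}
  {M : Type*} [TopologicalSpace M] [ChartedSpace H M] [IsManifold I ∞ M]

/-- A smooth Riemannian metric on the manifold `M`. -/
abbrev SmoothMetric (I : ModelWithCorners ℝ E H) (M : Type*) [TopologicalSpace M]
    [ChartedSpace H M] [IsManifold I ∞ M] :=
  ContMDiffRiemannianMetric I ∞ E (fun x : M => TangentSpace I x)

/-- A (globally defined) vector field on `M` is smooth. -/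
def IsSmoothVectorField (X : Π x : M, TangentSpace I x) : Prop :=
  ContMDiff I I.tangent ∞ (fun x => (⟨x, X x⟩ : TangentBundle I M))

/-- The right-hand side of the Koszul formula: the value at `x` of
`X g(Y,Z) + Y g(X,Z) - Z g(X,Y) + g([X,Y],Z) - g([X,Z],Y) - g([Y,Z],X)`. -/
def koszul (g : SmoothMetric I M) (X Y Z : Π x : M, TangentSpace I x) (x : M) : ℝ :=
  mvfderiv I (fun y => g.inner y (Y y) (Z y)) x (X x)
  + mvfderiv I (fun y => g.inner y (X y) (Z y)) x (Y x)
  - mvfderiv I (fun y => g.inner y (X y) (Y y)) x (Z x)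
  + g.inner x (VectorField.mlieBracket I X Y x) (Z x)
  - g.inner x (VectorField.mlieBracket I X Z x) (Y x)
  - g.inner x (VectorField.mlieBracket I Y Z x) (X x)

lemma mdifferentiableAt_metric (g : SmoothMetric I M) {X Y : Π x : M, TangentSpace I x} {x : M}
    (hX : MDiffAt (T% X) x) (hY : MDiffAt (T% Y) x) :
    MDiffAt (fun y => g.inner y (X y) (Y y)) x := by
  have : MDifferentiableAt I (I.prod 𝓘(ℝ))
      (fun m ↦ TotalSpace.mk' ℝ (E := Bundle.Trivial M ℝ) m (g.inner m (X m) (Y m))) x := by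
    apply MDifferentiableAt.clm_bundle_apply₂ (F₁ := E) (F₂ := E)
    · exact g.contMDiff.mdifferentiableAt (by simp)
    · exact hX
    · exact hY
  simp only [mdifferentiableAt_totalSpace] at this
  exact this.2

lemma metric_smul_left (g : SmoothMetric I M) (f : M → ℝ) (X Z : Π x : M, TangentSpace I x) :
    (fun y => g.inner y ((f • X) y) (Z y)) = fun y => f y * g.inner y (X y) (Z y) := by
  ext y; simp

lemma metric_smul_right (g : SmoothMetric I M) (f : M → ℝ) (X Z : Π x : M, TangentSpace I x) :
    (fun y => g.inner y (X y) ((f • Z) y)) = fun y => f y * g.inner y (X y) (Z y) := by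
  ext y; simp

lemma metric_add_left (g : SmoothMetric I M) (X X' Z : Π x : M, TangentSpace I x) :
    (fun y => g.inner y ((X + X') y) (Z y)) =
      fun y => g.inner y (X y) (Z y) + g.inner y (X' y) (Z y) := by
  ext y; simp

lemma metric_add_right (g : SmoothMetric I M) (X Z Z' : Π x : M, TangentSpace I x) :
    (fun y => g.inner y (X y) ((Z + Z') y)) =
      fun y => g.inner y (X y) (Z y) + g.inner y (X y) (Z' y) := by
  ext y; simp

end Riemannian

section LeviCivita

variable {E : Type*} [NormedAddCommGroup E] [NormedSpace ℝ E] [FiniteDimensional ℝ E]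
  {H : Type*} [TopologicalSpace H] {I : ModelWithCorners ℝ E H}
  {M : Type*} [TopologicalSpace M] [ChartedSpace H M] [IsManifold I ∞ M]

instance finiteDimensional_tangentSpace (x : M) : FiniteDimensional ℝ (TangentSpace I x) :=
  inferInstanceAs (FiniteDimensional ℝ E)

instance t2Space_tangentSpace (x : M) : T2Space (TangentSpace I x) :=
  inferInstanceAs (T2Space E)

lemma koszul_tensorial_left (g : SmoothMetric I M) {Y Z : Π x : M, TangentSpace I x} {x : M}
    (hY : MDiffAt (T% Y) x) (hZ : MDiffAt (T% Z) x) :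
    TensorialAt I E (fun X => koszul g X Y Z x) x where
  smul {f X} hf hX := by
    simp only [koszul, metric_smul_left, mvfderiv_fun_mul hf (mdifferentiableAt_metric g hX hZ),
      mvfderiv_fun_mul hf (mdifferentiableAt_metric g hX hY),
      VectorField.mlieBracket_smul_left hf hX]
    simp
    ring
  add {X X'} hX hX' := by
    simp only [koszul, metric_add_left,
      mvfderiv_fun_add (mdifferentiableAt_metric g hX hZ) (mdifferentiableAt_metric g hX' hZ),
      mvfderiv_fun_add (mdifferentiableAt_metric g hX hY) (mdifferentiableAt_metric g hX' hY),
      VectorField.mlieBracket_add_left hX hX']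
    simp
    ring

lemma koszul_tensorial_right (g : SmoothMetric I M) {X Y : Π x : M, TangentSpace I x} {x : M}
    (hX : MDiffAt (T% X) x) (hY : MDiffAt (T% Y) x) :
    TensorialAt I E (fun Z => koszul g X Y Z x) x where
  smul {f Z} hf hZ := by
    simp only [koszul, metric_smul_right, mvfderiv_fun_mul hf (mdifferentiableAt_metric g hX hZ),
      mvfderiv_fun_mul hf (mdifferentiableAt_metric g hY hZ),
      VectorField.mlieBracket_smul_right hf hZ]
    simp [g.symm x (Z x)]
    ring
  add {Z Z'} hZ hZ' := by
    simp only [koszul, metric_add_right,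
      mvfderiv_fun_add (mdifferentiableAt_metric g hX hZ) (mdifferentiableAt_metric g hX hZ'),
      mvfderiv_fun_add (mdifferentiableAt_metric g hY hZ) (mdifferentiableAt_metric g hY hZ'),
      VectorField.mlieBracket_add_right hZ hZ']
    simp
    ring

/-- The musical isomorphism `v ↦ g(v, ·)` of the tangent space at `x` with its dual. -/
def flat (g : SmoothMetric I M) (x : M) :
    TangentSpace I x ≃ₗ[ℝ] (TangentSpace I x →L[ℝ] ℝ) :=
  LinearEquiv.ofInjectiveOfFinrankEq (g.inner x : TangentSpace I x →ₗ[ℝ] _)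
    (by
      rw [← LinearMap.ker_eq_bot, LinearMap.ker_eq_bot']
      intro v hv
      by_contra hne
      have := g.pos x v hne
      have h0 : g.inner x v = 0 := hv
      simp [h0] at this)
    (by
      rw [← (LinearMap.toContinuousLinearMap :
        (TangentSpace I x →ₗ[ℝ] ℝ) ≃ₗ[ℝ] (TangentSpace I x →L[ℝ] ℝ)).finrank_eq]
      exact (Subspace.dual_finrank_eq (K := ℝ) (V := TangentSpace I x)).symm)

lemma flat_apply (g : SmoothMetric I M) (x : M) (v w : TangentSpace I x) :
    flat g x v w = g.inner x v w := rfl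

open Classical in
/-- The value at `x` of the Levi-Civita derivative of a vector field `Y`, as a linear map
`v ↦ ∇_v Y`: the vector `∇_X Y` is determined by the Koszul formula
`2 g(∇_X Y, Z) = koszul X Y Z` (and is `0` by convention where `Y` is not differentiable). -/
def leviCivitaFun (g : SmoothMetric I M) (Y : Π x : M, TangentSpace I x) (x : M) :
    TangentSpace I x →L[ℝ] TangentSpace I x :=
  if hY : MDiffAt (T% Y) x then
    (LinearMap.toContinuousLinearMap ((flat g x).symm : _ →ₗ[ℝ] TangentSpace I x)) ∘L
      ((1 / 2 : ℝ) • TensorialAt.mkHom₂ (fun X Z => koszul g X Y Z x) x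
        (fun _ hZ => koszul_tensorial_left g hY hZ)
        (fun _ hX => koszul_tensorial_right g hX hY))
  else 0

lemma leviCivitaFun_koszul (g : SmoothMetric I M) {X Y Z : Π x : M, TangentSpace I x} {x : M}
    (hX : MDiffAt (T% X) x) (hY : MDiffAt (T% Y) x) (hZ : MDiffAt (T% Z) x) :
    2 * g.inner x (leviCivitaFun g Y x (X x)) (Z x) = koszul g X Y Z x := by
  rw [leviCivitaFun, dif_pos hY, ← flat_apply]
  simp [TensorialAt.mkHom₂_apply (Φ := fun X Z => koszul g X Y Z x)
    (fun _ hZ => koszul_tensorial_left g hY hZ)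
    (fun _ hX => koszul_tensorial_right g hX hY) hX hZ]

lemma metric_ext (g : SmoothMetric I M) {x : M} {v w : TangentSpace I x}
    (h : ∀ Z : Π x : M, TangentSpace I x, MDiffAt (T% Z) x →
      2 * g.inner x v (Z x) = 2 * g.inner x w (Z x)) : v = w := by
  apply (flat g x).injective
  ext z
  have := h (FiberBundle.extend E z) (FiberBundle.mdifferentiableAt_extend ..)
  simp only [flat_apply]
  simpa using this

/-- The Levi-Civita connection of the metric `g`; `leviCivita g Y x (X x)` is `(∇_X Y)(x)`. -/
def leviCivita (g : SmoothMetric I M) :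
    CovariantDerivative I E (fun x : M => TangentSpace I x) where
  toFun := leviCivitaFun g
  isCovariantDerivativeOnUniv :=
    { add := by
        intro Y Y' x hY hY' _
        ext v
        obtain ⟨X, hX, rfl⟩ : ∃ X : Π x : M, TangentSpace I x, MDiffAt (T% X) x ∧ X x = v :=
          ⟨FiberBundle.extend E v, FiberBundle.mdifferentiableAt_extend .., by simp⟩
        refine metric_ext g fun Z hZ => ?_
        rw [leviCivitaFun_koszul g hX (mdifferentiableAt_add_section hY hY') hZ,
          add_apply, map_add, add_apply, mul_add,
          leviCivitaFun_koszul g hX hY hZ, leviCivitaFun_koszul g hX hY' hZ]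
        simp only [koszul, metric_add_left, metric_add_right,
          mvfderiv_fun_add (mdifferentiableAt_metric g hY hZ) (mdifferentiableAt_metric g hY' hZ),
          mvfderiv_fun_add (mdifferentiableAt_metric g hX hY) (mdifferentiableAt_metric g hX hY'),
          VectorField.mlieBracket_add_left hY hY', VectorField.mlieBracket_add_right hY hY']
        simp
        ring
      leibniz := by
        intro Y f x hY hf _
        ext v
        obtain ⟨X, hX, rfl⟩ : ∃ X : Π x : M, TangentSpace I x, MDiffAt (T% X) x ∧ X x = v :=
          ⟨FiberBundle.extend E v, FiberBundle.mdifferentiableAt_extend .., by simp⟩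
        refine metric_ext g fun Z hZ => ?_
        have e := leviCivitaFun_koszul g hX hY hZ
        rw [leviCivitaFun_koszul g hX (hf.smul_section hY) hZ]
        have e2 : 2 * g.inner x ((f x • leviCivitaFun g Y x +
            (mvfderiv I f x).smulRight (Y x)) (X x)) (Z x) =
            f x * (2 * g.inner x (leviCivitaFun g Y x (X x)) (Z x)) +
              2 * (mvfderiv I f x (X x) * g.inner x (Y x) (Z x)) := by
          simp
          ring
        rw [e2, e]
        simp only [koszul, metric_smul_left, metric_smul_right,
          mvfderiv_fun_mul hf (mdifferentiableAt_metric g hY hZ),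
          mvfderiv_fun_mul hf (mdifferentiableAt_metric g hX hY),
          VectorField.mlieBracket_smul_left hf hY, VectorField.mlieBracket_smul_right hf hY]
        simp [g.symm x (Y x) (X x)]
        ring }

/-- The covariant derivative `∇_X Y` of vector fields. -/
def nabla (g : SmoothMetric I M) (X Y : Π x : M, TangentSpace I x) :
    Π x : M, TangentSpace I x :=
  fun x => leviCivita g Y x (X x)

/-- The connection is torsion free. -/
lemma nabla_torsion_free (g : SmoothMetric I M) {X Y : Π x : M, TangentSpace I x} {x : M}
    (hX : MDiffAt (T% X) x) (hY : MDiffAt (T% Y) x) :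
    nabla g X Y x - nabla g Y X x = VectorField.mlieBracket I X Y x := by
  refine metric_ext g fun Z hZ => ?_
  have e1 := leviCivitaFun_koszul g hX hY hZ
  have e2 := leviCivitaFun_koszul g hY hX hZ
  change 2 * g.inner x (leviCivitaFun g Y x (X x) - leviCivitaFun g X x (Y x)) (Z x) = _
  rw [map_sub, sub_apply, mul_sub, e1, e2, koszul, koszul,
    VectorField.mlieBracket_swap_apply (V := Y) (W := X)]
  have : (fun y => g.inner y (X y) (Y y)) = fun y => g.inner y (Y y) (X y) :=
    funext fun y => g.symm y _ _
  rw [this]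
  simp
  ring

/-- The connection is compatible with the metric. -/
lemma nabla_metric (g : SmoothMetric I M) {X Y Z : Π x : M, TangentSpace I x} {x : M}
    (hX : MDiffAt (T% X) x) (hY : MDiffAt (T% Y) x) (hZ : MDiffAt (T% Z) x) :
    mvfderiv I (fun y => g.inner y (Y y) (Z y)) x (X x) =
      g.inner x (nabla g X Y x) (Z x) + g.inner x (Y x) (nabla g X Z x) := by
  have e1 := leviCivitaFun_koszul g hX hY hZ
  have e2 := leviCivitaFun_koszul g hX hZ hY
  change _ = g.inner x (leviCivitaFun g Y x (X x)) (Z x) +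
    g.inner x (Y x) (leviCivitaFun g Z x (X x))
  rw [g.symm x (Y x)]
  rw [koszul] at e1 e2
  rw [VectorField.mlieBracket_swap_apply (V := Z) (W := Y)] at e2
  have : (fun y => g.inner y (Z y) (Y y)) = fun y => g.inner y (Y y) (Z y) :=
    funext fun y => g.symm y _ _
  rw [this] at e2
  simp at e2
  linarith

/-- The curvature operator `R_{XY} Z = ∇_X ∇_Y Z - ∇_Y ∇_X Z - ∇_{[X,Y]} Z`. -/
def curvature (g : SmoothMetric I M) (X Y Z : Π x : M, TangentSpace I x) :
    Π x : M, TangentSpace I x :=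
  fun x => nabla g X (nabla g Y Z) x - nabla g Y (nabla g X Z) x
    - nabla g (VectorField.mlieBracket I X Y) Z x

/-- The Riemann-Christoffel curvature tensor `R(X,Y,Z,W) = -g(R_{XY} Z, W)`. -/
def riemannTensor (g : SmoothMetric I M) (X Y Z W : Π x : M, TangentSpace I x) (x : M) : ℝ :=
  - g.inner x (curvature g X Y Z x) (W x)

end LeviCivita

section Contact

variable {E : Type*} [NormedAddCommGroup E] [NormedSpace ℝ E]
  {H : Type*} [TopologicalSpace H]

/-- An almost contact metric structure `(φ, ξ, η, g)` on the manifold `M`: a smooth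
`(1,1)`-tensor field `φ`, a smooth vector field `ξ`, a smooth one-form `η` and a smooth Riemannian
metric `g` with `η(ξ) = 1`, `φ² = -Id + η ⊗ ξ` and `g(φ X, φ Y) = g(X, Y) - η(X) η(Y)`. -/
structure AlmostContactMetricStructure (I : ModelWithCorners ℝ E H) (M : Type*)
    [TopologicalSpace M] [ChartedSpace H M] [IsManifold I ∞ M] where
  φ : Π x : M, TangentSpace I x →L[ℝ] TangentSpace I x
  ξ : Π x : M, TangentSpace I x
  η : Π x : M, TangentSpace I x →L[ℝ] ℝ
  g : SmoothMetric I M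
  φ_smooth : ContMDiff I (I.prod 𝓘(ℝ, E →L[ℝ] E)) ∞
    (fun x => TotalSpace.mk' (E →L[ℝ] E)
      (E := fun x : M => TangentSpace I x →L[ℝ] TangentSpace I x) x (φ x))
  ξ_smooth : IsSmoothVectorField ξ
  η_smooth : ContMDiff I (I.prod 𝓘(ℝ, E →L[ℝ] ℝ)) ∞
    (fun x => TotalSpace.mk' (E →L[ℝ] ℝ)
      (E := fun x : M => TangentSpace I x →L[ℝ] Bundle.Trivial M ℝ x) x (η x))
  η_ξ : ∀ x, η x (ξ x) = 1
  φ_sq : ∀ x v, φ x (φ x v) = -v + η x v • ξ x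
  compatible : ∀ x v w, g.inner x (φ x v) (φ x w) = g.inner x v w - η x v * η x w

namespace AlmostContactMetricStructure

variable {I : ModelWithCorners ℝ E H}
  {M : Type*} [TopologicalSpace M] [ChartedSpace H M] [IsManifold I ∞ M]

/-- The vector field `φ X`. -/
def φv (S : AlmostContactMetricStructure I M) (X : Π x : M, TangentSpace I x) :
    Π x : M, TangentSpace I x :=
  fun x => S.φ x (X x)

/-- The exterior derivative of `η`, with the normalization
`dη(X,Y) = ½ (X η(Y) - Y η(X) - η([X,Y]))`. -/
def dη (S : AlmostContactMetricStructure I M) (X Y : Π x : M, TangentSpace I x) (x : M) : ℝ :=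
  (1 / 2 : ℝ) * (mvfderiv I (fun y => S.η y (Y y)) x (X x)
    - mvfderiv I (fun y => S.η y (X y)) x (Y x)
    - S.η x (VectorField.mlieBracket I X Y x))

/-- The structure is a contact metric structure: `dη(X,Y) = g(X, φ Y)`. Since
`dη(X, φ X) = -g(X, X)` for `X` in `ker η`, the form `dη` is then nondegenerate on `ker η`,
that is, `η` is a contact form. -/
def IsContactMetric (S : AlmostContactMetricStructure I M) : Prop :=
  ∀ X Y : Π x : M, TangentSpace I x, IsSmoothVectorField X → IsSmoothVectorField Y →
    ∀ x, S.dη X Y x = S.g.inner x (X x) (S.φ x (Y x))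

/-- The Nijenhuis torsion
`[φ,φ](X,Y) = φ²[X,Y] + [φX,φY] - φ[φX,Y] - φ[X,φY]`. -/
def nijenhuis (S : AlmostContactMetricStructure I M) (X Y : Π x : M, TangentSpace I x) :
    Π x : M, TangentSpace I x :=
  fun x => S.φ x (S.φ x (VectorField.mlieBracket I X Y x))
    + VectorField.mlieBracket I (S.φv X) (S.φv Y) x
    - S.φ x (VectorField.mlieBracket I (S.φv X) Y x)
    - S.φ x (VectorField.mlieBracket I X (S.φv Y) x)

/-- The structure is normal: `[φ,φ] + 2 dη ⊗ ξ = 0`. -/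
def IsNormal (S : AlmostContactMetricStructure I M) : Prop :=
  ∀ X Y : Π x : M, TangentSpace I x, IsSmoothVectorField X → IsSmoothVectorField Y →
    ∀ x, S.nijenhuis X Y x + (2 * S.dη X Y x) • S.ξ x = 0

/-- A Sasakian structure is a normal contact metric structure. -/
def IsSasakian (S : AlmostContactMetricStructure I M) : Prop :=
  S.IsContactMetric ∧ S.IsNormal

/-- The tensor field `h = ½ L_ξ φ`, that is, `h X = ½ ([ξ, φ X] - φ [ξ, X])`. -/
def h (S : AlmostContactMetricStructure I M) (X : Π x : M, TangentSpace I x) :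
    Π x : M, TangentSpace I x :=
  fun x => (1 / 2 : ℝ) • (VectorField.mlieBracket I S.ξ (S.φv X) x
    - S.φ x (VectorField.mlieBracket I S.ξ X x))

variable [FiniteDimensional ℝ E]

/-- The vector field `ξ` belongs to the `(κ, μ)`-nullity distribution:
`R_{XY} ξ = κ (η(Y) X - η(X) Y) + μ (η(Y) h X - η(X) h Y)`. -/
def IsNullity (S : AlmostContactMetricStructure I M) (κ μ : ℝ) : Prop :=
  ∀ X Y : Π x : M, TangentSpace I x, IsSmoothVectorField X → IsSmoothVectorField Y →
    ∀ x, curvature S.g X Y S.ξ x =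
      κ • (S.η x (Y x) • X x - S.η x (X x) • Y x)
      + μ • (S.η x (Y x) • S.h X x - S.η x (X x) • S.h Y x)

/-- The `(G1)` curvature identity. -/
def IsG1 (S : AlmostContactMetricStructure I M) : Prop :=
  ∀ X Y Z W : Π x : M, TangentSpace I x, IsSmoothVectorField X → IsSmoothVectorField Y →
    IsSmoothVectorField Z → IsSmoothVectorField W → ∀ x,
    riemannTensor S.g X Y (S.φv Z) (S.φv W) x - riemannTensor S.g X Y Z W x =
      S.g.inner x (Y x) (S.φ x (W x)) * S.g.inner x (X x) (S.φ x (Z x))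
      - S.g.inner x (X x) (S.φ x (W x)) * S.g.inner x (Y x) (S.φ x (Z x))
      + S.g.inner x (X x) (W x) * S.g.inner x (Y x) (Z x)
      - S.g.inner x (Y x) (W x) * S.g.inner x (X x) (Z x)

end AlmostContactMetricStructure

end Contact

end

/-! Taking `Z = ξ` in (G1) and using `φξ = 0` gives `R_{XY} ξ = η(Y) X - η(X) Y`. The rest shows
that a contact metric structure with this curvature is Sasakian.

Put `B = ∇ξ + φ`. The contact condition says that the skew-adjoint part of `∇ξ` is `-φ`, so `B` is
self-adjoint; moreover `η ∘ B = 0`, `Bξ = 0` and `∇_ξ ξ = 0`. The value of `R_{Xξ} ξ` is a Riccati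
equation for `∇ξ = B - φ`, and its self-adjoint and skew-adjoint parts are `∇_ξ B = -B²` and `∇_ξ φ
= -(φB + Bφ)` (`riccati_parts`). Differentiating `φ² = -I + η ⊗ ξ` along `ξ` then forces `φB = -Bφ`,
hence `∇_ξ φ = 0` (`φ_deviation`). Differentiating `φB = -Bφ` along `ξ` gives `φB² = -B²φ`, while
anticommutation alone gives `φB² = B²φ`; so `B² = 0`, and `B = 0` by self-adjointness
(`deviation_eq_zero`).

Now `∇ξ = -φ`, and the curvature identity becomes `(∇_X φ)Y - (∇_Y φ)X = η(X) Y - η(Y) X`, from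
which normality follows algebraically (`isNormal`). Also `h = 0`, so comparison with the nullity
condition on a nonzero vector of `ker η` yields `κ = 1`. -/

noncomputable section

/-! ### Smooth vector fields: extension from a point, closure under bracket and `∇`. -/

section SmoothFields

variable {E : Type*} [NormedAddCommGroup E] [NormedSpace ℝ E]
  {H : Type*} [TopologicalSpace H] {I : ModelWithCorners ℝ E H}
  {M : Type*} [TopologicalSpace M] [ChartedSpace H M]

lemma contMDiffAt_matrix_det {ι : Type*} [Fintype ι] [DecidableEq ι] {A : M → Matrix ι ι ℝ}
    {x : M} (hA : ∀ i j, ContMDiffAt I 𝓘(ℝ) ∞ (fun y => A y i j) x) :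
    ContMDiffAt I 𝓘(ℝ) ∞ (fun y => (A y).det) x := by
  simp only [Matrix.det_apply']
  exact ContMDiffAt.sum fun σ _ => contMDiffAt_const.mul (contMDiffAt_finsetProd fun i _ => hA _ _)

lemma contMDiffAt_matrix_inv_apply {ι : Type*} [Fintype ι] [DecidableEq ι] {A : M → Matrix ι ι ℝ}
    {x : M} (hA : ∀ i j, ContMDiffAt I 𝓘(ℝ) ∞ (fun y => A y i j) x) (h : (A x).det ≠ 0) (i j : ι) :
    ContMDiffAt I 𝓘(ℝ) ∞ (fun y => (A y)⁻¹ i j) x := by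
  simp only [Matrix.inv_def, Matrix.smul_apply, Matrix.adjugate_apply, Ring.inverse_eq_inv',
    smul_eq_mul]
  refine ((contMDiffAt_matrix_det hA).inv₀ h).mul (contMDiffAt_matrix_det fun k l => ?_)
  simp only [Matrix.updateRow_apply]
  split_ifs
  · exact contMDiffAt_const
  · exact hA k l

variable [IsManifold I ∞ M]

lemma IsSmoothVectorField.mdifferentiableAt {X : Π x : M, TangentSpace I x}
    (hX : IsSmoothVectorField X) (x : M) : MDiffAt (T% X) x :=
  ContMDiffAt.mdifferentiableAt (hX x) (by simp)

lemma contMDiff_metric (g : SmoothMetric I M) {X Y : Π x : M, TangentSpace I x}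
    (hX : IsSmoothVectorField X) (hY : IsSmoothVectorField Y) :
    ContMDiff I 𝓘(ℝ) ∞ (fun y => g.inner y (X y) (Y y)) := by
  intro x
  have : ContMDiffAt I (I.prod 𝓘(ℝ)) ∞
      (fun m ↦ TotalSpace.mk' ℝ (E := Bundle.Trivial M ℝ) m (g.inner m (X m) (Y m))) x :=
    ContMDiffAt.clm_bundle_apply₂ (F₁ := E) (F₂ := E) g.contMDiff.contMDiffAt (hX x) (hY x)
  simp only [contMDiffAt_totalSpace] at this
  exact this.2

lemma contMDiff_mvfderiv_apply {f : M → ℝ} {X : Π x : M, TangentSpace I x}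
    (hf : ContMDiff I 𝓘(ℝ) ∞ f) (hX : IsSmoothVectorField X) :
    ContMDiff I 𝓘(ℝ) ∞ (fun x => mvfderiv I f x (X x)) :=
  (contMDiff_snd_tangentBundle_modelSpace ℝ 𝓘(ℝ)).comp
    ((hf.contMDiff_tangentMap (m := ∞) (by simp)).comp hX)

variable [FiniteDimensional ℝ E]

/-- A vector field that is smooth near a point agrees near that point with a smooth one. -/
lemma exists_isSmoothVectorField_eventuallyEq [T2Space M] {X : Π x : M, TangentSpace I x}
    {u : Set M} {x₀ : M} (hu : IsOpen u) (hx₀ : x₀ ∈ u)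
    (hX : ContMDiffOn I I.tangent ∞ (fun x => (⟨x, X x⟩ : TangentBundle I M)) u) :
    ∃ Y : Π x : M, TangentSpace I x, IsSmoothVectorField Y ∧ ∀ᶠ x in nhds x₀, Y x = X x := by
  obtain ⟨f, hf, -⟩ := (SmoothBumpFunction.nhds_basis_support (I := I)
    (hu.mem_nhds hx₀)).mem_iff.1 (hu.mem_nhds hx₀)
  refine ⟨(f : M → ℝ) • X, ContMDiffOn.smul_section_of_tsupport f.contMDiff.contMDiffOn hu hf hX, ?_⟩
  filter_upwards [f.eventuallyEq_one] with x hx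
  simp [hx]

/-- The contact and curvature hypotheses concern global smooth fields; this extension lets tensorial
consequences be stated for single tangent vectors. -/
lemma exists_isSmoothVectorField_eq [T2Space M] {x : M} (v : TangentSpace I x) :
    ∃ X : Π x : M, TangentSpace I x, IsSmoothVectorField X ∧ X x = v := by
  obtain ⟨s, hs, h⟩ := FiberBundle.exists_contMDiffOn_extend (k := ∞) I E v
  obtain ⟨u, hus, hu, hxu⟩ := mem_nhds_iff.1 hs
  obtain ⟨Y, hY, hYv⟩ := exists_isSmoothVectorField_eventuallyEq hu hxu (h.mono hus)
  exact ⟨Y, hY, by rw [hYv.self_of_nhds]; simp⟩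

lemma IsSmoothVectorField.mlieBracket {X Y : Π x : M, TangentSpace I x}
    (hX : IsSmoothVectorField X) (hY : IsSmoothVectorField Y) :
    IsSmoothVectorField (VectorField.mlieBracket I X Y) := by
  have : IsManifold I ((⊤ : ℕ∞) + 1) M := inferInstanceAs (IsManifold I ∞ M)
  have : IsManifold I (minSmoothness ℝ 2) M := by
    rw [minSmoothness_of_isRCLikeNormedField]
    exact .of_le (n := ∞) ENat.LEInfty.out
  exact ContDiff.mlieBracket_vectorField (m := ⊤) (n := ⊤) hX hY (by simp)

lemma contMDiff_koszul (g : SmoothMetric I M) {X Y Z : Π x : M, TangentSpace I x}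
    (hX : IsSmoothVectorField X) (hY : IsSmoothVectorField Y) (hZ : IsSmoothVectorField Z) :
    ContMDiff I 𝓘(ℝ) ∞ (koszul g X Y Z) :=
  (((((contMDiff_mvfderiv_apply (contMDiff_metric g hY hZ) hX).add
    (contMDiff_mvfderiv_apply (contMDiff_metric g hX hZ) hY)).sub
    (contMDiff_mvfderiv_apply (contMDiff_metric g hX hY) hZ)).add
    (contMDiff_metric g (hX.mlieBracket hY) hZ)).sub
    (contMDiff_metric g (hX.mlieBracket hZ) hY)).sub
    (contMDiff_metric g (hY.mlieBracket hZ) hX)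

/-- A vector field is smooth as soon as its inner products with smooth vector fields are. -/
lemma isSmoothVectorField_of_metric [T2Space M] (g : SmoothMetric I M)
    {V : Π x : M, TangentSpace I x}
    (hV : ∀ Z : Π x : M, TangentSpace I x, IsSmoothVectorField Z →
      ContMDiff I 𝓘(ℝ) ∞ (fun y => g.inner y (V y) (Z y))) :
    IsSmoothVectorField V := by
  intro x₀
  classical
  set e := trivializationAt E (TangentSpace I : M → Type _) x₀
  let b := Module.finBasis ℝ E
  have hx₀ : x₀ ∈ e.baseSet := FiberBundle.mem_baseSet_trivializationAt' x₀
  choose F hF hFe using fun i => exists_isSmoothVectorField_eventuallyEq e.open_baseSet hx₀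
    (e.contMDiffOn_localFrame_baseSet ∞ b i)
  -- The Gram matrix of the frame. It is invertible near `x₀`, so the coefficients of `V` are its
  -- inverse applied to the smooth functions `g(V, F j)`; the inverse has smooth entries by Cramer's
  -- rule.
  let Γ : M → Matrix _ _ ℝ := fun y => Matrix.of fun i j => g.inner y (F j y) (F i y)
  have hΓ : ∀ i j, ContMDiffAt I 𝓘(ℝ) ∞ (fun y => Γ y i j) x₀ :=
    fun i j => (contMDiff_metric g (hF j) (hF i)).contMDiffAt
  have key : ∀ᶠ y in nhds x₀, IsUnit (Γ y) ∧ ∃ c : Fin _ → ℝ, V y = ∑ i, c i • F i y := by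
    filter_upwards [Filter.eventually_all.2 hFe, e.open_baseSet.mem_nhds hx₀] with y hy hye
    have hFb : ∀ i, F i y = e.basisAt b hye i := fun i => by
      rw [hy i, e.localFrame_apply_of_mem_baseSet b hye]
    refine ⟨?_, (e.basisAt b hye).repr (V y), ?_⟩
    -- A kernel vector gives a combination `w` of the frame orthogonal to every frame vector, hence
    -- to itself.
    · rw [← Matrix.mulVec_injective_iff_isUnit, ← Matrix.coe_mulVecLin, ← LinearMap.ker_eq_bot,
        LinearMap.ker_eq_bot']
      intro c hc
      set w := ∑ i, c i • F i y with hw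
      have h0 : ∀ i, g.inner y w (F i y) = 0 := fun i => by
        have := congrFun hc i
        simp only [Matrix.mulVecLin_apply, Matrix.mulVec, dotProduct, Γ, Matrix.of_apply,
          Pi.zero_apply] at this
        rw [hw, map_sum, sum_apply, ← this]
        simp [mul_comm]
      have h1 : g.inner y w w = 0 := by
        have : g.inner y w (∑ i, c i • F i y) = 0 := by simp [h0]
        rwa [← hw] at this
      have h2 : w = 0 := by
        by_contra hne
        exact (g.pos y w hne).ne' h1
      have h3 : ∑ i, c i • e.basisAt b hye i = 0 := by
        rw [← h2, hw]
        simp [hFb]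
      funext i
      exact Fintype.linearIndependent_iff.1 (e.basisAt b hye).linearIndependent c h3 i
    · simp_rw [hFb]
      exact ((e.basisAt b hye).sum_repr (V y)).symm
  let d := fun i y => ∑ j, (Γ y)⁻¹ i j * g.inner y (V y) (F j y)
  have hd : ∀ i, ContMDiffAt I 𝓘(ℝ) ∞ (d i) x₀ := fun i =>
    ContMDiffAt.sum fun j _ => (contMDiffAt_matrix_inv_apply hΓ
      ((Matrix.isUnit_iff_isUnit_det _).1 key.self_of_nhds.1).ne_zero i j).mul
      (hV _ (hF j)).contMDiffAt
  have hs : ContMDiffAt I I.tangent ∞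
      (fun x => (⟨x, ∑ i, (d i • F i) x⟩ : TangentBundle I M)) x₀ :=
    ContMDiffAt.sum_section fun i _ => (hd i).smul_section (hF i x₀)
  refine hs.congr_of_eventuallyEq ?_
  filter_upwards [key] with y ⟨hu, c, hc⟩
  have : (Γ y).mulVec c = fun j => g.inner y (V y) (F j y) := by
    funext j
    rw [hc, map_sum, sum_apply]
    simp [Matrix.mulVec, dotProduct, Γ, mul_comm]
  have hdc : ∀ i, d i y = c i := fun i => by
    have h2 := congrArg (fun v => (Γ y)⁻¹.mulVec v) this
    simp only [Matrix.mulVec_mulVec,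
      Matrix.nonsing_inv_mul _ ((Matrix.isUnit_iff_isUnit_det _).1 hu), Matrix.one_mulVec] at h2
    rw [h2]
    rfl
  simp [hdc, hc]

/-- The Koszul formula exhibits the inner products with smooth fields as smooth. This is what allows
`∇ξ` to be differentiated again. -/
lemma IsSmoothVectorField.nabla [T2Space M] (g : SmoothMetric I M)
    {X Y : Π x : M, TangentSpace I x}
    (hX : IsSmoothVectorField X) (hY : IsSmoothVectorField Y) :
    IsSmoothVectorField (nabla g X Y) := by
  refine isSmoothVectorField_of_metric g fun Z hZ => ?_
  have h : (fun y => g.inner y (_root_.nabla g X Y y) (Z y)) =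
      fun y => (1 / 2 : ℝ) * koszul g X Y Z y := by
    funext y
    rw [← leviCivitaFun_koszul g (hX.mdifferentiableAt y) (hY.mdifferentiableAt y)
      (hZ.mdifferentiableAt y)]
    change _ = (1 / 2 : ℝ) * (2 * g.inner y (leviCivita g Y y (X y)) (Z y))
    rw [_root_.nabla]
    ring
  rw [h]
  exact contMDiff_const.mul (contMDiff_koszul g hX hY hZ)

end SmoothFields

/-! ### Rules for `∇` and for covariant derivatives of endomorphism fields. -/

section NablaCalculus

variable {E : Type*} [NormedAddCommGroup E] [NormedSpace ℝ E]
  {H : Type*} [TopologicalSpace H] {I : ModelWithCorners ℝ E H}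
  {M : Type*} [TopologicalSpace M] [ChartedSpace H M] [IsManifold I ∞ M]

lemma SmoothMetric.inner_self_eq_zero (g : SmoothMetric I M) {x : M} {v : TangentSpace I x}
    (h : g.inner x v v = 0) : v = 0 := by
  by_contra hne
  exact (g.pos x v hne).ne' h

lemma SmoothMetric.ext_inner (g : SmoothMetric I M) {x : M} {v w : TangentSpace I x}
    (h : ∀ u, g.inner x v u = g.inner x w u) : v = w := by
  refine sub_eq_zero.1 (g.inner_self_eq_zero ?_)
  rw [map_sub (g.inner x), sub_apply, h, sub_self]

variable [FiniteDimensional ℝ E]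

lemma nabla_add (g : SmoothMetric I M) (X : Π x : M, TangentSpace I x)
    {Y Z : Π x : M, TangentSpace I x}
    (hY : IsSmoothVectorField Y) (hZ : IsSmoothVectorField Z) (x : M) :
    nabla g X (Y + Z) x = nabla g X Y x + nabla g X Z x := by
  have := (leviCivita g).isCovariantDerivativeOnUniv.add (hY.mdifferentiableAt x)
    (hZ.mdifferentiableAt x)
  exact congrArg (fun A => A (X x)) this

lemma nabla_smul (g : SmoothMetric I M) (X : Π x : M, TangentSpace I x)
    {Y : Π x : M, TangentSpace I x} {f : M → ℝ} (hf : ContMDiff I 𝓘(ℝ) ∞ f)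
    (hY : IsSmoothVectorField Y) (x : M) :
    nabla g X (f • Y) x = f x • nabla g X Y x + mvfderiv I f x (X x) • Y x := by
  have := (leviCivita g).isCovariantDerivativeOnUniv.leibniz (hY.mdifferentiableAt x)
    ((hf x).mdifferentiableAt (by simp))
  exact congrArg (fun A => A (X x)) this

lemma nabla_zero_right (g : SmoothMetric I M) (X : Π x : M, TangentSpace I x) (x : M) :
    nabla g X 0 x = 0 := by
  simp [nabla, (leviCivita g).zero]

lemma nabla_neg (g : SmoothMetric I M) (X : Π x : M, TangentSpace I x)
    {Y : Π x : M, TangentSpace I x} (hY : IsSmoothVectorField Y) (x : M) :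
    nabla g X (-Y) x = -nabla g X Y x := by
  have := nabla_add g X hY (ContMDiff.neg_section hY) x
  rw [add_neg_cancel, nabla_zero_right] at this
  exact (neg_eq_of_add_eq_zero_right this.symm).symm

/-- The covariant derivative `(∇_X T) Y = ∇_X (T Y) - T (∇_X Y)` of a field of endomorphisms. -/
def nablaEnd (g : SmoothMetric I M) (X : Π x : M, TangentSpace I x)
    (T : Π x : M, TangentSpace I x →L[ℝ] TangentSpace I x) (Y : Π x : M, TangentSpace I x)
    (x : M) : TangentSpace I x :=
  nabla g X (fun y => T y (Y y)) x - T x (nabla g X Y x)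

/-- The covariant derivative of a self-adjoint (`ε = 1`) or skew-adjoint (`ε = -1`) field of
endomorphisms is again self-adjoint, respectively skew-adjoint. -/
lemma inner_nablaEnd (g : SmoothMetric I M) {X Y Z : Π x : M, TangentSpace I x}
    {T : Π x : M, TangentSpace I x →L[ℝ] TangentSpace I x} {ε : ℝ}
    (hT : ∀ x v w, g.inner x (T x v) w = ε * g.inner x v (T x w))
    (hX : IsSmoothVectorField X) (hY : IsSmoothVectorField Y) (hZ : IsSmoothVectorField Z)
    (hTY : IsSmoothVectorField fun y => T y (Y y)) (hTZ : IsSmoothVectorField fun y => T y (Z y))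
    (x : M) :
    g.inner x (nablaEnd g X T Y x) (Z x) = ε * g.inner x (Y x) (nablaEnd g X T Z x) := by
  have h1 := nabla_metric g (hX.mdifferentiableAt x) (hTY.mdifferentiableAt x)
    (hZ.mdifferentiableAt x)
  have h2 := nabla_metric g (hX.mdifferentiableAt x) (hY.mdifferentiableAt x)
    (hTZ.mdifferentiableAt x)
  simp only [hT] at h1
  rw [mvfderiv_fun_mul mdifferentiableAt_const
    ((contMDiff_metric g hY hTZ).mdifferentiableAt (by simp))] at h1
  simp only [nablaEnd, map_sub, sub_apply, hT]
  simp only [mvfderiv_const, add_apply, smul_apply, smul_eq_mul, zero_apply, mul_zero, add_zero,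
    h2] at h1
  linarith

end NablaCalculus

namespace AlmostContactMetricStructure

/-! ### Pointwise algebra of almost contact metric structures. -/

section Pointwise

variable {E : Type*} [NormedAddCommGroup E] [NormedSpace ℝ E]
  {H : Type*} [TopologicalSpace H] {I : ModelWithCorners ℝ E H}
  {M : Type*} [TopologicalSpace M] [ChartedSpace H M] [IsManifold I ∞ M]
  (S : AlmostContactMetricStructure I M)

/-- Since `φ²ξ = 0`, the formula for `φ²` at `φξ` makes `φξ` a multiple `cξ`; then `c²ξ = φ²ξ = 0`.
-/
lemma φ_ξ (x : M) : S.φ x (S.ξ x) = 0 := by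
  have h1 : S.φ x (S.φ x (S.ξ x)) = 0 := by simp [S.φ_sq, S.η_ξ]
  have h2 := S.φ_sq x (S.φ x (S.ξ x))
  rw [h1, map_zero] at h2
  obtain ⟨c, h3⟩ : ∃ c : ℝ, S.φ x (S.ξ x) = c • S.ξ x := ⟨_, neg_add_eq_zero.1 h2.symm⟩
  have h4 := h1
  rw [h3, map_smul, h3, smul_smul, smul_eq_zero] at h4
  rcases h4 with h4 | h4
  · rw [h3, mul_self_eq_zero.1 h4, zero_smul]
  · rw [h4, map_zero]

/-- Evaluating `φ³v` as `φ²(φv)` and as `φ(φ²v)` leaves `η(φv) ξ = 0`. -/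
lemma η_φ (x : M) (v : TangentSpace I x) : S.η x (S.φ x v) = 0 := by
  have h1 := S.φ_sq x (S.φ x v)
  rw [S.φ_sq x v, map_add, map_neg, map_smul, φ_ξ, smul_zero, add_zero, left_eq_add] at h1
  have h2 := congrArg (S.η x) h1
  rwa [map_smul, S.η_ξ, smul_eq_mul, mul_one, map_zero] at h2

lemma inner_ξ (x : M) (v : TangentSpace I x) : S.g.inner x v (S.ξ x) = S.η x v := by
  have := S.compatible x v (S.ξ x)
  rw [φ_ξ, map_zero, S.η_ξ, mul_one] at this
  exact sub_eq_zero.1 this.symm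

lemma ξ_inner (x : M) (v : TangentSpace I x) : S.g.inner x (S.ξ x) v = S.η x v := by
  rw [S.g.symm, inner_ξ]

lemma inner_φ_left (x : M) (v w : TangentSpace I x) :
    S.g.inner x (S.φ x v) w = -S.g.inner x v (S.φ x w) := by
  have := S.compatible x v (S.φ x w)
  rw [S.φ_sq, map_add, map_neg, map_smul, inner_ξ, η_φ, η_φ, smul_zero, mul_zero] at this
  linarith

lemma isSmoothVectorField_φv {X : Π x : M, TangentSpace I x} (hX : IsSmoothVectorField X) :
    IsSmoothVectorField (S.φv X) :=
  ContMDiff.clm_bundle_apply (F₁ := E) (F₂ := E) S.φ_smooth hX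

lemma contMDiff_η {Y : Π x : M, TangentSpace I x} (hY : IsSmoothVectorField Y) :
    ContMDiff I 𝓘(ℝ) ∞ fun y => S.η y (Y y) := by
  simpa only [inner_ξ] using contMDiff_metric S.g hY S.ξ_smooth

end Pointwise

/-! ### The covariant derivative of `ξ`, and the curvature forced by (G1). -/

section Connection

variable {E : Type*} [NormedAddCommGroup E] [NormedSpace ℝ E] [FiniteDimensional ℝ E]
  {H : Type*} [TopologicalSpace H] {I : ModelWithCorners ℝ E H}
  {M : Type*} [TopologicalSpace M] [ChartedSpace H M] [IsManifold I ∞ M]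
  (S : AlmostContactMetricStructure I M)

/-- The field `ξ` has constant length 1. As only `X x` matters, `X` may be replaced by a
differentiable extension of that vector. -/
lemma η_nabla_ξ (X : Π x : M, TangentSpace I x) (x : M) : S.η x (nabla S.g X S.ξ x) = 0 := by
  have hξ := S.ξ_smooth.mdifferentiableAt x
  obtain ⟨Y, hY, hYX⟩ : ∃ Y : Π x : M, TangentSpace I x, MDiffAt (T% Y) x ∧ Y x = X x :=
    ⟨FiberBundle.extend E (X x), FiberBundle.mdifferentiableAt_extend .., by simp⟩
  have h := nabla_metric S.g hY hξ hξ
  have h1 : (fun y => S.g.inner y (S.ξ y) (S.ξ y)) = fun _ => (1 : ℝ) :=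
    funext fun y => by rw [inner_ξ, S.η_ξ]
  rw [h1, mvfderiv_const, inner_ξ, ξ_inner, zero_apply] at h
  rw [nabla, ← hYX]
  change 0 = S.η x (leviCivita S.g S.ξ x (Y x)) + S.η x (leviCivita S.g S.ξ x (Y x)) at h
  linarith

lemma mvfderiv_η {X Y : Π x : M, TangentSpace I x} (hX : IsSmoothVectorField X)
    (hY : IsSmoothVectorField Y) (x : M) :
    mvfderiv I (fun y => S.η y (Y y)) x (X x) =
      S.η x (nabla S.g X Y x) + S.g.inner x (nabla S.g X S.ξ x) (Y x) := by
  have h := nabla_metric S.g (hX.mdifferentiableAt x) (hY.mdifferentiableAt x)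
    (S.ξ_smooth.mdifferentiableAt x)
  simp only [inner_ξ] at h
  rw [h, S.g.symm x (Y x)]

lemma nabla_φv_φv {X Y : Π x : M, TangentSpace I x} (hY : IsSmoothVectorField Y) (x : M) :
    nabla S.g X (S.φv (S.φv Y)) x = -nabla S.g X Y x +
      (S.η x (Y x) • nabla S.g X S.ξ x + mvfderiv I (fun y => S.η y (Y y)) x (X x) • S.ξ x) := by
  have h : S.φv (S.φv Y) = -Y + (fun y => S.η y (Y y)) • S.ξ := funext fun y => S.φ_sq y (Y y)
  rw [h, nabla_add _ _ (ContMDiff.neg_section hY)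
    (ContMDiff.smul_section (S.contMDiff_η hY) S.ξ_smooth), nabla_neg _ _ hY,
    nabla_smul _ _ (S.contMDiff_η hY) S.ξ_smooth]

variable {S}

/-- For a torsion-free metric connection `dη` is the skew-adjoint part of `∇ξ`; the contact
condition identifies that part with `-φ`. -/
lemma IsContactMetric.inner_nabla_ξ_sub (hS : S.IsContactMetric) {X Y : Π x : M, TangentSpace I x}
    (hX : IsSmoothVectorField X) (hY : IsSmoothVectorField Y) (x : M) :
    S.g.inner x (nabla S.g X S.ξ x) (Y x) - S.g.inner x (X x) (nabla S.g Y S.ξ x) =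
      2 * S.g.inner x (X x) (S.φ x (Y x)) := by
  rw [← hS X Y hX hY x, dη, S.mvfderiv_η hX hY, S.mvfderiv_η hY hX,
    ← nabla_torsion_free S.g (hX.mdifferentiableAt x) (hY.mdifferentiableAt x), map_sub,
    S.g.symm x (X x)]
  ring

/-- The `(G1)` identity determines the curvature in the direction of `ξ`. -/
lemma IsG1.curvature_ξ [T2Space M] (hS : S.IsG1) {X Y : Π x : M, TangentSpace I x}
    (hX : IsSmoothVectorField X) (hY : IsSmoothVectorField Y) (x : M) :
    curvature S.g X Y S.ξ x = S.η x (Y x) • X x - S.η x (X x) • Y x := by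
  refine S.g.ext_inner fun w => ?_
  obtain ⟨W, hW, rfl⟩ := exists_isSmoothVectorField_eq w
  have h := hS X Y S.ξ W hX hY S.ξ_smooth hW x
  have h0 : S.φv S.ξ = 0 := funext fun y => S.φ_ξ y
  have h1 : curvature S.g X Y 0 x = 0 := by
    have (Z : Π x : M, TangentSpace I x) : nabla S.g Z 0 = 0 := funext (nabla_zero_right S.g Z)
    simp [curvature, this]
  simp only [h0, riemannTensor, h1, φ_ξ, inner_ξ, map_zero, zero_apply] at h
  simp only [map_sub, map_smul, sub_apply, smul_apply, smul_eq_mul]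
  linarith

end Connection

/-! ### The self-adjoint part `B` of `∇ξ`, written `deviation`. -/

section Sasakian

variable {E : Type*} [NormedAddCommGroup E] [NormedSpace ℝ E] [FiniteDimensional ℝ E]
  {H : Type*} [TopologicalSpace H] {I : ModelWithCorners ℝ E H}
  {M : Type*} [TopologicalSpace M] [ChartedSpace H M] [IsManifold I ∞ M]
  (S : AlmostContactMetricStructure I M)

/-- The deviation `v ↦ ∇_v ξ + φ v` of `∇ξ` from its value on a K-contact manifold. -/
def deviation (x : M) : TangentSpace I x →L[ℝ] TangentSpace I x :=
  leviCivita S.g S.ξ x + S.φ x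

lemma nabla_ξ_eq (X : Π x : M, TangentSpace I x) (x : M) :
    nabla S.g X S.ξ x = S.deviation x (X x) - S.φ x (X x) := by
  simp [deviation, nabla]

variable [T2Space M]

lemma isSmoothVectorField_deviation {X : Π x : M, TangentSpace I x}
    (hX : IsSmoothVectorField X) : IsSmoothVectorField fun x => S.deviation x (X x) :=
  ContMDiff.add_section (hX.nabla S.g S.ξ_smooth) (S.isSmoothVectorField_φv hX)

lemma η_deviation (x : M) (v : TangentSpace I x) : S.η x (S.deviation x v) = 0 := by
  obtain ⟨X, -, rfl⟩ := exists_isSmoothVectorField_eq v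
  have := S.η_nabla_ξ X x
  rwa [nabla_ξ_eq, map_sub, η_φ, sub_zero] at this

variable {S}

namespace IsContactMetric

variable (hS : S.IsContactMetric)
include hS

lemma inner_deviation (x : M) (v w : TangentSpace I x) :
    S.g.inner x (S.deviation x v) w = S.g.inner x v (S.deviation x w) := by
  obtain ⟨X, hX, rfl⟩ := exists_isSmoothVectorField_eq v
  obtain ⟨Y, hY, rfl⟩ := exists_isSmoothVectorField_eq w
  have h := hS.inner_nabla_ξ_sub hX hY x
  rw [nabla_ξ_eq, nabla_ξ_eq] at h
  simp only [map_sub, sub_apply, inner_φ_left] at h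
  linarith

lemma deviation_ξ (x : M) : S.deviation x (S.ξ x) = 0 := by
  refine S.g.ext_inner fun w => ?_
  rw [hS.inner_deviation, ξ_inner, η_deviation, map_zero, zero_apply]

lemma nabla_ξ_ξ : nabla S.g S.ξ S.ξ = 0 := by
  funext x
  rw [nabla_ξ_eq, hS.deviation_ξ, φ_ξ, sub_zero, Pi.zero_apply]

/-- Differentiating `φ² = -Id + η ⊗ ξ` along `ξ`. -/
lemma nablaEnd_φ_φ {X : Π x : M, TangentSpace I x} (hX : IsSmoothVectorField X) (x : M) :
    nablaEnd S.g S.ξ S.φ (S.φv X) x + S.φ x (nablaEnd S.g S.ξ S.φ X x) = 0 := by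
  have h := S.nabla_φv_φv (X := S.ξ) hX x
  -- Because `∇_ξ ξ = 0`, the tensor `η ⊗ ξ` is parallel along `ξ`.
  rw [hS.nabla_ξ_ξ, S.mvfderiv_η S.ξ_smooth hX, hS.nabla_ξ_ξ] at h
  change nabla S.g S.ξ (S.φv (S.φv X)) x - S.φ x (nabla S.g S.ξ (S.φv X) x) +
    S.φ x (nabla S.g S.ξ (S.φv X) x - S.φ x (nabla S.g S.ξ X x)) = 0
  rw [h, map_sub, S.φ_sq]
  simp

end IsContactMetric

/-- The curvature identity `R_{XY} ξ = η(Y) X - η(X) Y` of Sasakian manifolds. -/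
def HasSasakianCurvature (S : AlmostContactMetricStructure I M) : Prop :=
  ∀ X Y : Π x : M, TangentSpace I x, IsSmoothVectorField X → IsSmoothVectorField Y →
    ∀ x, curvature S.g X Y S.ξ x = S.η x (Y x) • X x - S.η x (X x) • Y x

/-! ### From the curvature identity to `B = 0`, and then to normality. -/

namespace IsContactMetric

variable (hS : S.IsContactMetric) (hR : S.HasSasakianCurvature)
include hS hR

/-- With `A = ∇ξ`, the vanishing of `∇_ξ ξ` gives `R_{Xξ} ξ = -(∇_ξ A)X - A²X`, so the curvature
identity reads `∇_ξ A + A² = φ²`. Substituting `A = B - φ` cancels `φ²`, and the terms are sorted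
with the self-adjoint ones on the left and the skew-adjoint ones on the right. -/
lemma riccati {X : Π x : M, TangentSpace I x} (hX : IsSmoothVectorField X) (x : M) :
    nablaEnd S.g S.ξ S.deviation X x + S.deviation x (S.deviation x (X x)) =
      S.φ x (S.deviation x (X x)) + S.deviation x (S.φ x (X x)) + nablaEnd S.g S.ξ S.φ X x := by
  have h := hR X S.ξ hX S.ξ_smooth x
  have h1 : nabla S.g X S.ξ = (fun y => S.deviation y (X y)) + -S.φv X :=
    funext fun y => by rw [nabla_ξ_eq, sub_eq_add_neg]; rfl
  rw [curvature, hS.nabla_ξ_ξ, nabla_zero_right, h1,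
    nabla_add _ _ (S.isSmoothVectorField_deviation hX)
      (ContMDiff.neg_section (S.isSmoothVectorField_φv hX)),
    nabla_neg _ _ (S.isSmoothVectorField_φv hX), nabla_ξ_eq,
    ← nabla_torsion_free S.g (hX.mdifferentiableAt x) (S.ξ_smooth.mdifferentiableAt x),
    nabla_ξ_eq, S.η_ξ, one_smul] at h
  simp only [map_sub, S.φ_sq] at h
  change nabla S.g S.ξ (fun y => S.deviation y (X y)) x - S.deviation x (nabla S.g S.ξ X x) + _ =
    _ + _ + (nabla S.g S.ξ (S.φv X) x - S.φ x (nabla S.g S.ξ X x))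
  rw [← sub_eq_zero] at h ⊢
  rw [← neg_eq_zero, ← h]
  module

/-- The self-adjoint and the skew-adjoint part of the Riccati equation. -/
lemma riccati_parts {X : Π x : M, TangentSpace I x} (hX : IsSmoothVectorField X) (x : M) :
    nablaEnd S.g S.ξ S.deviation X x = -S.deviation x (S.deviation x (X x)) ∧
      nablaEnd S.g S.ξ S.φ X x =
        -(S.φ x (S.deviation x (X x)) + S.deviation x (S.φ x (X x))) := by
  have h1 : nablaEnd S.g S.ξ S.deviation X x + S.deviation x (S.deviation x (X x)) = 0 := by
    refine S.g.ext_inner fun w => ?_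
    obtain ⟨Y, hY, rfl⟩ := exists_isSmoothVectorField_eq w
    have hs := inner_nablaEnd S.g (ε := 1) (T := S.deviation)
      (fun x v w => by rw [hS.inner_deviation, one_mul]) S.ξ_smooth hX hY
      (S.isSmoothVectorField_deviation hX) (S.isSmoothVectorField_deviation hY) x
    have ha := inner_nablaEnd S.g (ε := -1) (T := S.φ)
      (fun x v w => by rw [inner_φ_left, neg_one_mul]) S.ξ_smooth hX hY
      (S.isSmoothVectorField_φv hX) (S.isSmoothVectorField_φv hY) x
    -- Pairing the equation for `X` with `Y` and the equation for `Y` with `X`: the left side keeps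
    -- its sign under the swap and the right side changes it, so both vanish.
    have hx := congrArg (fun v => S.g.inner x v (Y x)) (hS.riccati hR hX x)
    have hy := congrArg (fun v => S.g.inner x (X x) v) (hS.riccati hR hY x)
    simp only [map_add, add_apply, inner_φ_left, hS.inner_deviation] at hx hy
    rw [map_add, add_apply, hS.inner_deviation, hS.inner_deviation, map_zero, zero_apply]
    linarith
  refine ⟨eq_neg_of_add_eq_zero_left h1, eq_neg_of_add_eq_zero_right ?_⟩
  rw [← hS.riccati hR hX, h1]

/-- Inserting `∇_ξ φ = -(φB + Bφ)` into `(∇_ξ φ)φ + φ(∇_ξ φ) = 0`, with `φ²B = Bφ² = -B`, gives `φBφ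
= B`; applying `φ` once more gives the claim. -/
lemma φ_deviation (x : M) (v : TangentSpace I x) :
    S.φ x (S.deviation x v) = -S.deviation x (S.φ x v) := by
  obtain ⟨X, hX, rfl⟩ := exists_isSmoothVectorField_eq v
  have h := hS.nablaEnd_φ_φ hX x
  rw [(hS.riccati_parts hR hX x).2, (hS.riccati_parts hR (S.isSmoothVectorField_φv hX) x).2] at h
  simp only [φv, S.φ_sq, map_add, map_neg, map_smul, hS.deviation_ξ, smul_zero, η_deviation,
    zero_smul, add_zero] at h
  have h2 : S.φ x (S.deviation x (S.φ x (X x))) = S.deviation x (X x) := by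
    rw [← sub_eq_zero, ← smul_eq_zero_iff_right (two_ne_zero : (2 : ℝ) ≠ 0), ← neg_eq_zero, ← h]
    module
  rw [← h2, S.φ_sq, η_deviation, zero_smul, add_zero]

lemma nablaEnd_φ_eq_zero {X : Π x : M, TangentSpace I x} (hX : IsSmoothVectorField X) (x : M) :
    nablaEnd S.g S.ξ S.φ X x = 0 := by
  rw [(hS.riccati_parts hR hX x).2, hS.φ_deviation hR, neg_add_cancel, neg_zero]

lemma deviation_eq_zero (x : M) (v : TangentSpace I x) : S.deviation x v = 0 := by
  obtain ⟨X, hX, rfl⟩ := exists_isSmoothVectorField_eq v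
  have hB := S.isSmoothVectorField_deviation hX
  have hφ := S.isSmoothVectorField_φv hX
  have h1 := hS.nablaEnd_φ_eq_zero hR hB x
  have h2 := (hS.riccati_parts hR hX x).1
  have h3 := (hS.riccati_parts hR hφ x).1
  have h4 := hS.nablaEnd_φ_eq_zero hR hX x
  -- The anticommutation `φB = -Bφ`, differentiated along `ξ`. With `∇_ξ φ = 0` and `∇_ξ B = -B²` it
  -- leaves `2 B²φ = 0`.
  have h5 : nabla S.g S.ξ (fun y => S.φ y (S.deviation y (X y))) x =
      -nabla S.g S.ξ (fun y => S.deviation y (S.φ y (X y))) x := by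
    refine Eq.trans ?_ (nabla_neg _ _ (S.isSmoothVectorField_deviation hφ) x)
    exact congrArg (nabla S.g S.ξ · x) (funext fun y => hS.φ_deviation hR y (X y))
  change nabla S.g S.ξ (S.φv X) x - _ = 0 at h4
  rw [sub_eq_zero] at h4
  simp only [nablaEnd, φv, sub_eq_zero] at h1 h2 h3
  rw [sub_eq_iff_eq_add] at h2 h3
  rw [h1, h2, h3, h4] at h5
  simp only [map_add, map_neg, hS.φ_deviation hR, neg_neg] at h5
  have h6 : S.deviation x (S.deviation x (S.φ x (X x))) = 0 := by
    rw [← smul_eq_zero_iff_right (two_ne_zero : (2 : ℝ) ≠ 0), ← neg_eq_zero, ← sub_eq_zero.2 h5]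
    module
  have h7 : S.φ x (S.deviation x (S.deviation x (X x))) = 0 := by
    rw [hS.φ_deviation hR, hS.φ_deviation hR, map_neg, neg_neg, h6]
  have h8 := S.φ_sq x (S.deviation x (S.deviation x (X x)))
  rw [h7, map_zero, η_deviation, zero_smul, add_zero, eq_comm, neg_eq_zero] at h8
  -- Self-adjointness gives `|BX|² = g(X, B²X)`.
  refine S.g.inner_self_eq_zero ?_
  rw [hS.inner_deviation, h8, map_zero]

/-- A contact metric structure with the curvature of a Sasakian one is K-contact. -/
lemma nabla_ξ (X : Π x : M, TangentSpace I x) : nabla S.g X S.ξ = -S.φv X := by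
  funext x
  rw [nabla_ξ_eq, hS.deviation_eq_zero hR, zero_sub]
  rfl

/-- In terms of `∇`, `2hX = (∇_ξ φ)X - ∇_{φX} ξ + φ(∇_X ξ)`. The first term vanishes, and the other
two cancel because `∇ξ = -φ`. -/
lemma h_eq_zero {X : Π x : M, TangentSpace I x} (hX : IsSmoothVectorField X) (x : M) :
    S.h X x = 0 := by
  have hφ := S.isSmoothVectorField_φv hX
  have h := hS.nablaEnd_φ_eq_zero hR hX x
  change nabla S.g S.ξ (S.φv X) x - _ = 0 at h
  rw [AlmostContactMetricStructure.h, ← nabla_torsion_free S.g (S.ξ_smooth.mdifferentiableAt x)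
    (hX.mdifferentiableAt x), ← nabla_torsion_free S.g (S.ξ_smooth.mdifferentiableAt x)
    (hφ.mdifferentiableAt x), hS.nabla_ξ hR, hS.nabla_ξ hR, sub_eq_zero.1 h]
  simp [φv]

/-- Once `∇ξ = -φ`, the curvature `R_{XY} ξ` involves only first derivatives of `φ`, namely `-((∇_X
φ)Y - (∇_Y φ)X)`. -/
lemma nabla_φv_sub {X Y : Π x : M, TangentSpace I x} (hX : IsSmoothVectorField X)
    (hY : IsSmoothVectorField Y) (x : M) :
    nabla S.g X (S.φv Y) x - nabla S.g Y (S.φv X) x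
      - S.φ x (VectorField.mlieBracket I X Y x) = S.η x (X x) • Y x - S.η x (Y x) • X x := by
  have h := hR X Y hX hY x
  rw [curvature, hS.nabla_ξ hR, hS.nabla_ξ hR, hS.nabla_ξ hR,
    nabla_neg _ _ (S.isSmoothVectorField_φv hX), nabla_neg _ _ (S.isSmoothVectorField_φv hY)] at h
  rw [← neg_sub (S.η x (Y x) • X x), ← h]
  simp only [φv, Pi.neg_apply]
  abel

/-- The sum of `nabla_φv_sub` at `(φX, Y)` and at `(X, φY)` is the normality equation: the
derivatives of `φ²X` and `φ²Y` supply the terms `X η(Y)` and `Y η(X)` of `dη`, and the terms in `φX`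
and `φY` cancel. -/
lemma isNormal : S.IsNormal := by
  intro X Y hX hY x
  have hφX := S.isSmoothVectorField_φv hX
  have hφY := S.isSmoothVectorField_φv hY
  have h1 := hS.nabla_φv_sub hR hφX hY x
  have h2 := hS.nabla_φv_sub hR hX hφY x
  rw [S.nabla_φv_φv hX, hS.nabla_ξ hR] at h1
  rw [S.nabla_φv_φv hY, hS.nabla_ξ hR] at h2
  rw [nijenhuis, dη, S.φ_sq, ← nabla_torsion_free S.g (hφX.mdifferentiableAt x)
    (hφY.mdifferentiableAt x), ← nabla_torsion_free S.g (hX.mdifferentiableAt x)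
    (hY.mdifferentiableAt x)]
  simp only [φv, Pi.neg_apply, η_φ, zero_smul, zero_sub, sub_zero] at h1 h2 ⊢
  have h3 := congrArg₂ (· + ·) h1 h2
  rw [← sub_eq_zero] at h3
  rw [← h3]
  module

end IsContactMetric
end Sasakian

end AlmostContactMetricStructure

end

theorem mainTheorem7 (n : ℕ) (M : Type*) [TopologicalSpace M] [T2Space M]
    [ChartedSpace (EuclideanSpace ℝ (Fin (2 * n + 1))) M] [IsManifold (𝓡 (2 * n + 1)) ∞ M]
    (S : AlmostContactMetricStructure (𝓡 (2 * n + 1)) M) (κ μ : ℝ)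
    (hcontact : S.IsContactMetric) (hnullity : S.IsNullity κ μ) (hG1 : S.IsG1) :
    S.IsSasakian ∧ (Nonempty M → 1 ≤ n → κ = 1) := by
  have hR : S.HasSasakianCurvature := fun X Y hX hY x => hG1.curvature_ξ hX hY x
  refine ⟨⟨hcontact, hcontact.isNormal hR⟩, ?_⟩
  rintro ⟨x⟩ hn
  -- For `n ≥ 1` the dimension `2n + 1` exceeds 1, so the functional `η` has a nonzero kernel.
  obtain ⟨v, hv, hv0⟩ : ∃ v, S.η x v = 0 ∧ v ≠ 0 := by
    have h : LinearMap.ker (S.η x : TangentSpace (𝓡 (2 * n + 1)) x →ₗ[ℝ] ℝ) ≠ ⊥ :=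
      LinearMap.ker_ne_bot_of_finrank_lt (by
        change Module.finrank ℝ ℝ < Module.finrank ℝ (EuclideanSpace ℝ (Fin (2 * n + 1)))
        rw [finrank_euclideanSpace_fin, Module.finrank_self]
        omega)
    exact (Submodule.ne_bot_iff _).1 h
  obtain ⟨X, hX, rfl⟩ := exists_isSmoothVectorField_eq v
  -- With `h X = 0` and `η(X) = 0` at `x`, the two expressions for `R_{Xξ} ξ` are `X` and `κX`; the
  -- remaining term in `hξ` carries the factor `η(X)`.
  have h := hnullity X S.ξ hX S.ξ_smooth x
  rw [hR X S.ξ hX S.ξ_smooth x, hcontact.h_eq_zero hR hX, hv, S.η_ξ] at h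
  simp only [one_smul, zero_smul, sub_zero, smul_zero, add_zero] at h
  have h1 : (1 - κ) • X x = 0 := by rw [sub_smul, one_smul, ← h, sub_self]
  linarith [(smul_eq_zero.1 h1).resolve_right hv0]
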